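/- Let $\mathcal{E} \subset \mathbb{R}^2$ be a (solid, non-degenerate) ellipse centred at the origin, let $N \ge 2$ be an integer, and let $x_1, \dots, x_N$ be independent random points distributed uniformly in $\mathcal{E}$. Define the random variable $$V_{\mathcal{E},N} = \frac{\operatorname{vol}_2\bigl(\operatorname{conv}\{\pm x_1, \pm x_2, \dots, \pm x_N\}\bigr)}{\operatorname{vol}_2(\mathcal{E})}.$$ Then $$\mathbb{E}\, V_{\mathcal{E},N} = 1 - \frac{2N}{3\pi^N} \int_0^\pi (t + \sin t)^{N-1} (1 + \cos t)^2 \, dt.$$ -/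

import Mathlib

/-- A (solid) ellipse in the plane centred at the origin: with respect to some orthonormal basis
`b` and some semi-axes `a 0, a 1 > 0`, the set of points `x` with
`(⟪b 0, x⟫ / a 0) ^ 2 + (⟪b 1, x⟫ / a 1) ^ 2 ≤ 1`. -/
def IsCenteredEllipse (E : Set (EuclideanSpace ℝ (Fin 2))) : Prop :=
  ∃ (b : OrthonormalBasis (Fin 2) ℝ (EuclideanSpace ℝ (Fin 2))) (a : Fin 2 → ℝ),
    (∀ i, 0 < a i) ∧ E = {x | ∑ i, (inner ℝ (b i) x / a i) ^ 2 ≤ 1}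

/-- The symmetric convex hull `conv {± x₁, …, ± x_N}` of finitely many points. -/
def symmetricHull {n N : ℕ} (x : Fin N → EuclideanSpace ℝ (Fin n)) :
    Set (EuclideanSpace ℝ (Fin n)) :=
  convexHull ℝ (Set.range x ∪ Set.range (fun i => -x i))

/-- The normalized volume `vol (conv {± x₁, …, ± x_N}) / vol K`. -/
noncomputable def normalizedSymVolume {n N : ℕ} (K : Set (EuclideanSpace ℝ (Fin n)))
    (x : Fin N → EuclideanSpace ℝ (Fin n)) : ℝ :=
  MeasureTheory.volume.real (symmetricHull x) / MeasureTheory.volume.real K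

open MeasureTheory Set
open scoped ENNReal

/-- The convex hull of the points `± x i` in a real vector space. -/
def symHull {ι V : Type*} [AddCommGroup V] [Module ℝ V] (x : ι → V) : Set V :=
  convexHull ℝ (range x ∪ range (fun i => -x i))

section SymHull

variable {ι V W : Type*} [AddCommGroup V] [Module ℝ V] [AddCommGroup W] [Module ℝ W]

lemma convex_symHull (x : ι → V) : Convex ℝ (symHull x) := convex_convexHull ℝ _

lemma mem_symHull (x : ι → V) (i : ι) : x i ∈ symHull x :=
  subset_convexHull ℝ _ (Or.inl ⟨i, rfl⟩)

lemma neg_mem_symHull (x : ι → V) (i : ι) : -x i ∈ symHull x :=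
  subset_convexHull ℝ _ (Or.inr ⟨i, rfl⟩)

lemma zero_mem_symHull (x : ι → V) (i : ι) : (0 : V) ∈ symHull x := by
  have h := convex_symHull x (mem_symHull x i) (neg_mem_symHull x i)
    (by norm_num : (0 : ℝ) ≤ 1 / 2) (by norm_num : (0 : ℝ) ≤ 1 / 2) (by norm_num)
  simpa using h

lemma symHull_subset {x : ι → V} {s : Set V} (hs : Convex ℝ s) (h : ∀ i, x i ∈ s)
    (h' : ∀ i, -x i ∈ s) : symHull x ⊆ s := by
  refine convexHull_min ?_ hs
  rintro _ (⟨i, rfl⟩ | ⟨i, rfl⟩)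
  exacts [h i, h' i]

lemma image_symHull (f : V →ₗ[ℝ] W) (x : ι → V) :
    f '' symHull x = symHull (fun i => f (x i)) := by
  rw [symHull, LinearMap.image_convexHull, image_union, ← range_comp, ← range_comp, symHull]
  simp [Function.comp_def]

lemma mem_symHull_iff [Fintype ι] {x : ι → V} {p : V} :
    p ∈ symHull x ↔ ∃ w ∈ stdSimplex ℝ (ι ⊕ ι),
      ∑ i, w (Sum.inl i) • x i - ∑ i, w (Sum.inr i) • x i = p := by
  have h : range x ∪ range (fun i => -x i) = range (Sum.elim x (fun i => -x i)) := by
    rw [Set.Sum.elim_range]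
  classical
  have h' : range (Sum.elim x (fun i => -x i)) =
      Fintype.linearCombination ℝ (Sum.elim x (fun i => -x i)) ''
        range (fun i : ι ⊕ ι => (Pi.single i 1 : ι ⊕ ι → ℝ)) := by
    rw [← range_comp]
    congr 1
    ext i
    simp [Fintype.linearCombination_apply_single]
  rw [symHull, h, h', ← LinearMap.image_convexHull, convexHull_rangle_single_eq_stdSimplex]
  simp [Fintype.linearCombination_apply, sub_eq_add_neg]

/-- The set of pairs `(x, p)` with `p` in the symmetric hull of `x` is closed. -/
lemma isClosed_setOf_mem_symHull [Fintype ι] [TopologicalSpace V] [T2Space V]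
    [ContinuousAdd V] [ContinuousSub V] [ContinuousSMul ℝ V] :
    IsClosed {y : (ι → V) × V | y.2 ∈ symHull y.1} := by
  have : {y : (ι → V) × V | y.2 ∈ symHull y.1} =
      Prod.snd '' {z : stdSimplex ℝ (ι ⊕ ι) × ((ι → V) × V) |
      ∑ i, z.1.1 (Sum.inl i) • z.2.1 i - ∑ i, z.1.1 (Sum.inr i) • z.2.1 i = z.2.2} := by
    ext y
    simp [mem_symHull_iff]
  rw [this]
  have : CompactSpace (stdSimplex ℝ (ι ⊕ ι)) :=
    isCompact_iff_compactSpace.1 (isCompact_stdSimplex ℝ (ι ⊕ ι))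
  apply isClosedMap_snd_of_compactSpace
  have hc : ∀ k, Continuous fun z : stdSimplex ℝ (ι ⊕ ι) × ((ι → V) × V) => z.1.1 k := fun k =>
    (continuous_apply k).comp (continuous_subtype_val.comp continuous_fst)
  refine isClosed_eq (Continuous.sub ?_ ?_) (by fun_prop) <;>
  · refine continuous_finsetSum _ fun i _ => (hc _).smul (by fun_prop)

end SymHull

/-- The determinant of two vectors of the plane. -/
def wedge (p q : ℂ) : ℝ := p.re * q.im - p.im * q.re

/-- Whichever of `z` and `-z` lies counterclockwise from `p`. -/
noncomputable def orient (p z : ℂ) : ℂ := if 0 < wedge p z then z else -z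

/-- The segment from `p` to the counterclockwise one of `± x i` is an edge of the symmetric hull
of `p` and `x`: all other points lie strictly between its line and the opposite one. -/
def IsEdgeFrom {ι : Type*} (p : ℂ) (x : ι → ℂ) (i : ι) : Prop :=
  wedge p (x i) ≠ 0 ∧ ∀ j ≠ i, |wedge (x j) (orient p (x i) - p)| < |wedge p (x i)|

lemma wedge_self (p : ℂ) : wedge p p = 0 := by simp [wedge, mul_comm]

lemma wedge_swap (p q : ℂ) : wedge q p = -wedge p q := by simp [wedge]; ring

lemma wedge_neg_right (p q : ℂ) : wedge p (-q) = -wedge p q := by simp [wedge]; ring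

lemma wedge_neg_left (p q : ℂ) : wedge (-p) q = -wedge p q := by simp [wedge]; ring

lemma wedge_sub_right (p q r : ℂ) : wedge p (q - r) = wedge p q - wedge p r := by
  simp [wedge]; ring

lemma continuous_wedge : Continuous fun y : ℂ × ℂ => wedge y.1 y.2 := by
  unfold wedge; fun_prop

lemma wedge_orient (p z : ℂ) : wedge p (orient p z) = |wedge p z| := by
  unfold orient
  split_ifs with h
  · rw [abs_of_pos h]
  · rw [wedge_neg_right, abs_of_nonpos (not_lt.1 h)]

lemma orient_eq_or (p z : ℂ) : orient p z = z ∨ orient p z = -z := by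
  unfold orient; split_ifs <;> simp

lemma abs_wedge_orient (p z w : ℂ) : |wedge (orient p z) w| = |wedge z w| := by
  rcases orient_eq_or p z with h | h <;> simp [h, wedge_neg_left]

lemma orient_mem_symHull {ι : Type*} (p : ℂ) (x : ι → ℂ) (i : ι) :
    orient p (x i) ∈ symHull x := by
  rcases orient_eq_or p (x i) with h | h <;> rw [h]
  exacts [mem_symHull x i, neg_mem_symHull x i]

lemma neg_orient_mem_symHull {ι : Type*} (p : ℂ) (x : ι → ℂ) (i : ι) :
    -orient p (x i) ∈ symHull x := by
  rcases orient_eq_or p (x i) with h | h <;> rw [h]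
  exacts [neg_mem_symHull x i, by simpa using mem_symHull x i]

lemma IsEdgeFrom.unique {ι : Type*} {p : ℂ} {x : ι → ℂ} {i j : ι} (hi : IsEdgeFrom p x i)
    (hj : IsEdgeFrom p x j) : i = j := by
  by_contra hij
  have h1 := hi.2 j (Ne.symm hij)
  have h2 := hj.2 i hij
  rw [← abs_wedge_orient p (x j), ← wedge_orient p (x i)] at h1
  rw [← abs_wedge_orient p (x i), ← wedge_orient p (x j)] at h2
  have h3 := lt_of_abs_lt h1
  have h4 := lt_of_abs_lt h2
  rw [wedge_sub_right] at h3 h4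
  linarith [wedge_swap (orient p (x i)) (orient p (x j)), wedge_swap (orient p (x i)) p,
    wedge_swap (orient p (x j)) p]

/-- An open half-plane together with one point of its boundary line is convex. -/
lemma convex_halfPlane_union_singleton {V : Type*} [AddCommGroup V] [Module ℝ V] (f : V →ₗ[ℝ] ℝ)
    (q : V) : Convex ℝ ({z | f z < f q} ∪ {q}) := by
  intro u hu v hv a b ha hb hab
  have key : f (a • u + b • v) = a * f u + b * f v := by simp
  rcases ha.eq_or_lt with rfl | ha
  · have : b = 1 := by linarith
    simpa [this] using hv
  rcases hb.eq_or_lt with rfl | hb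
  · have : a = 1 := by linarith
    simpa [this] using hu
  rcases hu with hu | hu <;> rcases hv with hv | hv
  · left
    simp only [mem_ofPred_eq] at *
    rw [key]
    calc a * f u + b * f v < a * f q + b * f q := by gcongr
      _ = f q := by rw [← add_mul, hab, one_mul]
  · left
    simp only [mem_ofPred_eq, mem_singleton_iff] at *
    subst hv
    rw [key]
    calc a * f u + b * f v < a * f v + b * f v := by gcongr
      _ = f v := by rw [← add_mul, hab, one_mul]
  · left
    simp only [mem_ofPred_eq, mem_singleton_iff] at *
    subst hu
    rw [key]
    calc a * f u + b * f v < a * f u + b * f u := by gcongr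
      _ = f u := by rw [← add_mul, hab, one_mul]
  · right
    simp only [mem_singleton_iff] at *
    rw [hu, hv, ← add_smul, hab, one_smul]

lemma IsEdgeFrom.notMem_symHull {ι : Type*} {p : ℂ} {x : ι → ℂ} {i : ι}
    (hi : IsEdgeFrom p x i) : p ∉ symHull x := by
  intro hp
  set q := orient p (x i) with hq
  have ha : 0 < wedge p q := by rw [hq, wedge_orient]; exact abs_pos.2 hi.1
  let f : ℂ →ₗ[ℝ] ℝ :=
    { toFun := fun z => wedge z (q - p)
      map_add' := fun u v => by simp [wedge]; ring
      map_smul' := fun c u => by simp [wedge]; ring }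
  have hf : ∀ z, f z = wedge z (q - p) := fun z => rfl
  have hfq : f q = wedge p q := by rw [hf, wedge_sub_right, wedge_self, wedge_swap p q]; ring
  have hfp : f p = wedge p q := by rw [hf, wedge_sub_right, wedge_self]; ring
  have hall : ∀ j, x j ∈ {z | f z < f q} ∪ {q} ∧ -x j ∈ {z | f z < f q} ∪ {q} := by
    intro j
    by_cases hj : j = i
    · subst hj
      have hnq : -q ∈ {z | f z < f q} ∪ {q} := by
        left; simp only [mem_ofPred_eq, map_neg, hfq]; linarith
      rcases orient_eq_or p (x j) with h | h
      · rw [← hq] at h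
        rw [← h]; exact ⟨by simp, hnq⟩
      · rw [← hq] at h
        rw [← h, ← neg_neg (x j), ← h]; exact ⟨hnq, by simp⟩
    · have h := hi.2 j hj
      rw [← wedge_orient p (x i), ← hq, abs_lt] at h
      refine ⟨Or.inl ?_, Or.inl ?_⟩
      · simp only [mem_ofPred_eq, hfq]; exact h.2
      · simp only [mem_ofPred_eq, hfq, hf, wedge_neg_left]; linarith
  have := symHull_subset (convex_halfPlane_union_singleton f q) (fun j => (hall j).1)
    (fun j => (hall j).2) hp
  rcases this with h | h
  · simp only [mem_ofPred_eq, hfq, hfp, lt_self_iff_false] at h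
  · simp only [mem_singleton_iff] at h
    rw [← h, wedge_self] at ha
    exact lt_irrefl _ ha

lemma exists_isEdgeFrom {ι : Type*} [Finite ι] [Nonempty ι] {p : ℂ} {x : ι → ℂ}
    (h0 : ∀ i, wedge p (x i) ≠ 0)
    (hne : ∀ i j, j ≠ i → |wedge (x j) (orient p (x i) - p)| ≠ |wedge p (x i)|)
    (hp : p ∉ symHull x) : ∃ i, IsEdgeFrom p x i := by
  let q : ι → ℂ := fun i => orient p (x i)
  have hq : ∀ i, 0 < wedge p (q i) := fun i => by
    simp only [q, wedge_orient]; exact abs_pos.2 (h0 i)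
  obtain ⟨i, hi⟩ := Finite.exists_min fun i =>
    (p.re ^ 2 + p.im ^ 2 - (p.re * (q i).re + p.im * (q i).im)) / wedge p (q i)
  refine ⟨i, h0 i, fun j hj => lt_of_le_of_ne ?_ (hne i j hj)⟩
  rw [← abs_wedge_orient p (x j), ← wedge_orient p (x i)]
  change |wedge (q j) (q i - p)| ≤ wedge p (q i)
  have hpp : 0 < p.re ^ 2 + p.im ^ 2 := by
    by_contra hcon
    have h1 : p.re = 0 := by nlinarith [sq_nonneg p.re, sq_nonneg p.im]
    have h2 : p.im = 0 := by nlinarith [sq_nonneg p.re, sq_nonneg p.im]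
    apply h0 i
    simp [wedge, h1, h2]
  rw [abs_le]
  constructor
  · by_contra! hcon
    apply hp
    set K := wedge (-q j) (q i) with hK
    have hKlt : wedge p (q i) + wedge p (q j) < K := by
      rw [wedge_sub_right, wedge_swap p (q j)] at hcon
      rw [hK, wedge_neg_left]; linarith
    have hs : 0 < wedge p (q i) + wedge p (q j) := add_pos (hq i) (hq j)
    have hK0 : 0 < K := hs.trans hKlt
    have hmem := convex_symHull x (neg_orient_mem_symHull p x j) (orient_mem_symHull p x i)
      (div_nonneg (hq i).le hs.le) (div_nonneg (hq j).le hs.le)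
      (by rw [← add_div, div_self hs.ne'])
    have hmem' := (convex_symHull x).smul_mem_of_zero_mem (zero_mem_symHull x i) hmem
      (t := (wedge p (q i) + wedge p (q j)) / K)
      ⟨div_nonneg hs.le hK0.le, (div_le_one hK0).2 hKlt.le⟩
    convert hmem' using 1
    change p = _ • (_ • (-q j) + _ • q i)
    have e : K • p = wedge p (q i) • (-q j) + wedge p (q j) • q i := by
      apply Complex.ext <;> simp [hK, wedge] <;> ring
    have e' : ∀ (c : ℝ) (w : ℂ), ((wedge p (q i) + wedge p (q j)) / K) •
        (c / (wedge p (q i) + wedge p (q j))) • w = K⁻¹ • c • w := fun c w => by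
      rw [smul_smul, smul_smul]; congr 1; field_simp
    rw [smul_add, e', e', ← smul_add, ← e, smul_smul, inv_mul_cancel₀ hK0.ne', one_smul]
  · have h := hi j
    rw [div_le_div_iff₀ (hq i) (hq j)] at h
    have e : (p.re ^ 2 + p.im ^ 2) * (wedge p (q i) - wedge (q j) (q i - p)) =
        (p.re ^ 2 + p.im ^ 2 - (p.re * (q j).re + p.im * (q j).im)) * wedge p (q i) -
        (p.re ^ 2 + p.im ^ 2 - (p.re * (q i).re + p.im * (q i).im)) * wedge p (q j) := by
      simp [wedge]; ring
    have : 0 ≤ (p.re ^ 2 + p.im ^ 2) * (wedge p (q i) - wedge (q j) (q i - p)) := by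
      rw [e]; linarith
    linarith [nonneg_of_mul_nonneg_right this hpp]

@[fun_prop]
lemma Measurable.wedge {α : Type*} [MeasurableSpace α] {f g : α → ℂ} (hf : Measurable f)
    (hg : Measurable g) : Measurable fun a => wedge (f a) (g a) :=
  continuous_wedge.measurable.comp (hf.prodMk hg)

@[fun_prop]
lemma Measurable.orient {α : Type*} [MeasurableSpace α] {f g : α → ℂ} (hf : Measurable f)
    (hg : Measurable g) : Measurable fun a => orient (f a) (g a) :=
  Measurable.ite (measurableSet_lt measurable_const (hf.wedge hg)) hg hg.neg

lemma measurableSet_isEdgeFrom {ι : Type*} [Countable ι] (i : ι) :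
    MeasurableSet {y : ℂ × (ι → ℂ) | IsEdgeFrom y.1 y.2 i} := by
  have hx : ∀ j, Measurable fun y : ℂ × (ι → ℂ) => y.2 j := fun j => by fun_prop
  unfold IsEdgeFrom
  refine MeasurableSet.inter (measurableSet_eq_fun (by fun_prop) measurable_const).compl ?_
  refine (MeasurableSet.iInter fun j => MeasurableSet.iInter fun (_ : j ≠ i) =>
    measurableSet_lt (f := fun y : ℂ × (ι → ℂ) => |wedge (y.2 j) (orient y.1 (y.2 i) - y.1)|)
      (g := fun y => |wedge y.1 (y.2 i)|) ?_ ?_).congr ?_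
  · exact ((hx j).wedge ((measurable_fst.orient (hx i)).sub measurable_fst)).abs
  · exact (measurable_fst.wedge (hx i)).abs
  · ext; simp; rfl

/-- The open strip between the line through `p` and `q` and its reflection in the origin. -/
def strip (p q : ℂ) : Set ℂ := {z | |wedge z (q - p)| < |wedge p q|}

lemma strip_comm (p q : ℂ) : strip p q = strip q p := by
  ext z
  simp only [strip, mem_ofPred_eq]
  rw [← neg_sub, wedge_neg_right, abs_neg, wedge_swap q p, abs_neg]

lemma measurableSet_strip : MeasurableSet {y : (ℂ × ℂ) × ℂ | y.2 ∈ strip y.1.1 y.1.2} :=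
  measurableSet_lt (f := fun y : (ℂ × ℂ) × ℂ => |wedge y.2 (y.1.2 - y.1.1)|)
    (g := fun y => |wedge y.1.1 y.1.2|)
    (measurable_snd.wedge (measurable_fst.snd.sub measurable_fst.fst)).abs
    (measurable_fst.fst.wedge measurable_fst.snd).abs

lemma abs_wedge_orient_right (p q : ℂ) : |wedge p (orient p q)| = |wedge p q| := by
  rw [wedge_orient, abs_abs]

section Measure

variable {μ : Measure ℂ}

lemma measurable_measure_strip [IsProbabilityMeasure μ] :
    Measurable fun y : ℂ × ℂ => μ (strip y.1 y.2) :=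
  measurable_measure_prodMk_left measurableSet_strip

lemma ae_ne_zero_of_line_null (hline : ∀ w ≠ 0, ∀ c, μ {z | wedge z w = c} = 0) :
    ∀ᵐ p ∂μ, p ≠ 0 := by
  refine measure_mono_null ?_ (hline 1 one_ne_zero 0)
  intro z hz
  have : z = 0 := by simpa using hz
  simp [this, wedge]

lemma ae_wedge_ne_zero (hline : ∀ w ≠ 0, ∀ c, μ {z | wedge z w = c} = 0) {p : ℂ} (hp : p ≠ 0) :
    ∀ᵐ q ∂μ, wedge p q ≠ 0 := by
  refine measure_mono_null ?_ (hline p hp 0)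
  intro z hz
  have : wedge p z = 0 := by simpa using hz
  simp [wedge_swap p z, this]

lemma ae_general_position [IsProbabilityMeasure μ]
    (hline : ∀ w ≠ 0, ∀ c, μ {z | wedge z w = c} = 0) (n : ℕ) :
    ∀ᵐ y ∂(μ.prod (Measure.pi fun _ : Fin (n + 1) => μ)), ∀ i, wedge y.1 (y.2 i) ≠ 0 ∧
      ∀ k, |wedge (y.2 (i.succAbove k)) (orient y.1 (y.2 i) - y.1)| ≠ |wedge y.1 (y.2 i)| := by
  refine ae_all_iff.2 fun i => ?_
  have hx : ∀ j, Measurable fun y : ℂ × (Fin (n + 1) → ℂ) => y.2 j := fun j => by fun_prop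
  refine (Measure.ae_prod_iff_ae_ae ?_).2 ?_
  · refine MeasurableSet.inter (measurableSet_eq_fun (by fun_prop) measurable_const).compl ?_
    refine (MeasurableSet.iInter fun k => (measurableSet_eq_fun
      (f := fun y : ℂ × (Fin (n + 1) → ℂ) =>
        |wedge (y.2 (i.succAbove k)) (orient y.1 (y.2 i) - y.1)|)
      (g := fun y => |wedge y.1 (y.2 i)|) ?_ ?_).compl).congr ?_
    · exact ((hx _).wedge ((measurable_fst.orient (hx i)).sub measurable_fst)).abs
    · exact (measurable_fst.wedge (hx i)).abs
    · ext; simp; rfl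
  filter_upwards [ae_ne_zero_of_line_null hline] with p hp
  have key : ∀ᵐ y ∂(μ.prod (Measure.pi fun _ : Fin n => μ)), wedge p y.1 ≠ 0 ∧
      ∀ k, |wedge (y.2 k) (orient p y.1 - p)| ≠ |wedge p y.1| := by
    have hz : ∀ j, Measurable fun y : ℂ × (Fin n → ℂ) => y.2 j := fun j => by fun_prop
    refine (Measure.ae_prod_iff_ae_ae ?_).2 ?_
    · refine MeasurableSet.inter (measurableSet_eq_fun (by fun_prop) measurable_const).compl ?_
      refine (MeasurableSet.iInter fun k => (measurableSet_eq_fun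
        (f := fun y : ℂ × (Fin n → ℂ) => |wedge (y.2 k) (orient p y.1 - p)|)
        (g := fun y => |wedge p y.1|) ?_ ?_).compl).congr ?_
      · exact ((hz _).wedge ((measurable_const.orient measurable_fst).sub measurable_const)).abs
      · exact (measurable_const.wedge measurable_fst).abs
      · ext; simp; rfl
    filter_upwards [ae_wedge_ne_zero hline hp] with q hq
    refine Filter.eventually_and.2 ⟨Filter.Eventually.of_forall fun _ => hq,
      ae_all_iff.2 fun k => ?_⟩
    have hw : orient p q - p ≠ 0 := by
      intro h
      have h1 := abs_wedge_orient_right p q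
      rw [sub_eq_zero.1 h, wedge_self, abs_zero] at h1
      exact hq (abs_eq_zero.1 h1.symm)
    have hz : ∀ᵐ z ∂μ, |wedge z (orient p q - p)| ≠ |wedge p q| := by
      refine measure_mono_null ?_ (measure_union_null (hline _ hw |wedge p q|)
        (hline _ hw (-|wedge p q|)))
      intro z hz
      have : |wedge z (orient p q - p)| = |wedge p q| := by simpa using hz
      rcases abs_eq (abs_nonneg _) |>.1 this with h | h
      exacts [Or.inl h, Or.inr h]
    exact (Measure.quasiMeasurePreserving_eval (fun _ : Fin n => μ) k).ae hz
  exact (measurePreserving_piFinSuccAbove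
    (fun _ : Fin (n + 1) => μ) i).quasiMeasurePreserving.ae key

lemma measure_isEdgeFrom [IsProbabilityMeasure μ]
    (hline : ∀ w ≠ 0, ∀ c, μ {z | wedge z w = c} = 0) (n : ℕ)
    (i : Fin (n + 1)) :
    (μ.prod (Measure.pi fun _ : Fin (n + 1) => μ)) {y | IsEdgeFrom y.1 y.2 i} =
      ∫⁻ y, μ (strip y.1 (orient y.1 y.2)) ^ n ∂(μ.prod μ) := by
  have hm : Measurable fun y : ℂ × ℂ => μ (strip y.1 (orient y.1 y.2)) ^ n :=
    (measurable_measure_strip.comp (measurable_fst.prodMk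
      (measurable_fst.orient measurable_snd))).pow_const n
  rw [Measure.prod_apply (measurableSet_isEdgeFrom i), lintegral_prod _ hm.aemeasurable]
  refine lintegral_congr_ae ?_
  filter_upwards [ae_ne_zero_of_line_null hline] with p hp
  have hz : ∀ j, Measurable fun y : ℂ × (Fin n → ℂ) => y.2 j := fun j => by fun_prop
  let T : Set (ℂ × (Fin n → ℂ)) :=
    {y | wedge p y.1 ≠ 0 ∧ ∀ k, |wedge (y.2 k) (orient p y.1 - p)| < |wedge p y.1|}
  have hT : MeasurableSet T := by
    refine MeasurableSet.inter (measurableSet_eq_fun (by fun_prop) measurable_const).compl ?_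
    refine (MeasurableSet.iInter fun k => (measurableSet_lt
      (f := fun y : ℂ × (Fin n → ℂ) => |wedge (y.2 k) (orient p y.1 - p)|)
      (g := fun y => |wedge p y.1|) ?_ ?_)).congr ?_
    · exact ((hz _).wedge ((measurable_const.orient measurable_fst).sub measurable_const)).abs
    · exact (measurable_const.wedge measurable_fst).abs
    · ext; simp; rfl
  have hpre : Prod.mk p ⁻¹' {y : ℂ × (Fin (n + 1) → ℂ) | IsEdgeFrom y.1 y.2 i} =
      MeasurableEquiv.piFinSuccAbove (fun _ => ℂ) i ⁻¹' T := by
    ext x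
    simp only [mem_preimage, mem_ofPred_eq, IsEdgeFrom, T]
    refine and_congr Iff.rfl ⟨fun h k => h _ (Fin.succAbove_ne i k), fun h j hj => ?_⟩
    obtain ⟨k, rfl⟩ := Fin.exists_succAbove_eq hj
    exact h k
  rw [hpre, (measurePreserving_piFinSuccAbove (fun _ : Fin (n + 1) => μ) i).measure_preimage
    hT.nullMeasurableSet, Measure.prod_apply hT]
  refine lintegral_congr_ae ?_
  filter_upwards [ae_wedge_ne_zero hline hp] with q hq
  have : Prod.mk q ⁻¹' T = Set.pi univ fun _ : Fin n => strip p (orient p q) := by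
    ext z
    simp [T, strip, hq, abs_wedge_orient_right]
  rw [this, Measure.pi_pi]
  simp

lemma lintegral_strip_orient [IsProbabilityMeasure μ]
    (hneg : MeasurePreserving (fun z : ℂ => -z) μ μ) (n : ℕ) :
    ∫⁻ y, μ (strip y.1 (orient y.1 y.2)) ^ n ∂(μ.prod μ) =
      ∫⁻ y, μ (strip y.1 y.2) ^ n ∂(μ.prod μ) := by
  let G : ℂ × ℂ → ℝ≥0∞ := fun y => μ (strip y.1 y.2) ^ n
  have hG : Measurable G := measurable_measure_strip.pow_const n
  let A : Set (ℂ × ℂ) := {y | 0 < wedge y.1 y.2}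
  have hA : MeasurableSet A := measurableSet_lt measurable_const (by fun_prop)
  have hT : MeasurePreserving (fun y : ℂ × ℂ => (-y.2, y.1)) (μ.prod μ) (μ.prod μ) :=
    (hneg.prod (MeasurePreserving.id μ)).comp Measure.measurePreserving_swap
  have h1 : ∀ y : ℂ × ℂ, μ (strip y.1 (orient y.1 y.2)) ^ n =
      A.indicator G y + Aᶜ.indicator G (-y.2, y.1) := by
    intro y
    have hw : wedge (-y.2) y.1 = wedge y.1 y.2 := by
      rw [wedge_neg_left, wedge_swap, neg_neg]
    by_cases h : 0 < wedge y.1 y.2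
    · simp [A, G, h, hw, orient]
    · simp [A, G, h, hw, orient, strip_comm y.1]
  simp_rw [h1]
  rw [lintegral_add_left (hG.indicator hA),
    hT.lintegral_comp (f := Aᶜ.indicator G) (hG.indicator hA.compl),
    ← lintegral_add_left (hG.indicator hA)]
  refine lintegral_congr fun y => ?_
  exact indicator_self_add_compl_apply A G y

/-- The probability that a random point is outside the symmetric hull of `n + 1` others, by
summing over the edge that leaves the point counterclockwise. -/
theorem measure_notMem_symHull [IsProbabilityMeasure μ]
    (hneg : MeasurePreserving (fun z : ℂ => -z) μ μ)
    (hline : ∀ w ≠ 0, ∀ c, μ {z | wedge z w = c} = 0) (n : ℕ) :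
    (μ.prod (Measure.pi fun _ : Fin (n + 1) => μ)) {y | y.1 ∉ symHull y.2} =
      (n + 1) * ∫⁻ y, μ (strip y.1 y.2) ^ n ∂(μ.prod μ) := by
  have hae : {y : ℂ × (Fin (n + 1) → ℂ) | y.1 ∉ symHull y.2}
      =ᵐ[μ.prod (Measure.pi fun _ : Fin (n + 1) => μ)] ⋃ i, {y | IsEdgeFrom y.1 y.2 i} := by
    filter_upwards [ae_general_position hline n] with y hy
    refine propext ?_
    change y.1 ∉ symHull y.2 ↔ y ∈ ⋃ i, {y : ℂ × (Fin (n + 1) → ℂ) | IsEdgeFrom y.1 y.2 i}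
    rw [mem_iUnion]
    refine ⟨fun h => exists_isEdgeFrom (fun i => (hy i).1) (fun i j hj => ?_) h,
      fun ⟨i, hi⟩ => IsEdgeFrom.notMem_symHull hi⟩
    obtain ⟨k, rfl⟩ := Fin.exists_succAbove_eq hj
    exact (hy i).2 k
  rw [measure_congr hae, measure_iUnion ?_ measurableSet_isEdgeFrom, tsum_fintype]
  · simp_rw [measure_isEdgeFrom hline, lintegral_strip_orient hneg]
    simp
  · intro i j hij
    refine disjoint_left.2 fun y hi hj => hij ?_
    exact IsEdgeFrom.unique hi hj

end Measure

lemma measurePreserving_circle_mul (c : Circle) :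
    MeasurePreserving (fun z : ℂ => (c : ℂ) * z) := by
  have h := (rotation c).measurePreserving
  exact h

lemma exists_circle_mul_norm (v : ℂ) : ∃ c : Circle, v = (‖v‖ : ℂ) * c :=
  ⟨Circle.exp v.arg, by rw [Circle.coe_exp, Complex.norm_mul_exp_arg_mul_I]⟩

lemma wedge_circle_mul (c : Circle) (z : ℂ) (r : ℝ) : wedge (c * z) (r * c) = -(r * z.im) := by
  have h : (c : ℂ).re ^ 2 + (c : ℂ).im ^ 2 = 1 := by
    have := Circle.normSq_coe c
    rw [Complex.normSq_apply] at this
    linarith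
  simp only [wedge, Complex.mul_re, Complex.mul_im, Complex.ofReal_re, Complex.ofReal_im]
  linear_combination (-(r * z.im)) * h

lemma lintegral_complex_eq (f : ℂ → ℝ≥0∞) (hf : Measurable f) :
    ∫⁻ z, f z = ∫⁻ y : ℝ, ∫⁻ x : ℝ, f ⟨x, y⟩ := by
  rw [← Complex.volume_preserving_equiv_real_prod.symm.lintegral_comp hf, Measure.volume_eq_prod,
    lintegral_prod_symm (fun a => f (Complex.measurableEquivRealProd.symm a))
      (hf.comp (MeasurableEquiv.measurable _)).aemeasurable]
  rfl

lemma volume_wedge_eq {w : ℂ} (hw : w ≠ 0) (a : ℝ) : volume {z | wedge z w = a} = 0 := by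
  obtain ⟨c, hc⟩ := exists_circle_mul_norm w
  have hm : ∀ v, MeasurableSet {z | wedge z v = a} := fun v =>
    measurableSet_eq_fun (measurable_id.wedge measurable_const) measurable_const
  have hr : ‖w‖ ≠ 0 := norm_ne_zero_iff.2 hw
  rw [hc, ← (measurePreserving_circle_mul c).measure_preimage (hm _).nullMeasurableSet]
  have : (fun z : ℂ => (c : ℂ) * z) ⁻¹' {z | wedge z (‖w‖ * c) = a} = {z | z.im = -a / ‖w‖} := by
    ext z
    simp only [mem_preimage, mem_ofPred_eq, wedge_circle_mul]
    rw [eq_div_iff hr]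
    constructor <;> intro h <;> linarith
  have hm' : MeasurableSet {z : ℂ | z.im = -a / ‖w‖} :=
    measurableSet_eq_fun Complex.measurable_im measurable_const
  rw [this, ← lintegral_indicator_one hm',
    lintegral_complex_eq _ (measurable_one.indicator hm')]
  rw [lintegral_eq_zero_iff' (by
    exact (Measurable.lintegral_prod_right' (f := fun y : ℝ × ℝ =>
      {z : ℂ | z.im = -a / ‖w‖}.indicator (1 : ℂ → ℝ≥0∞) ⟨y.2, y.1⟩) (
        (measurable_one.indicator hm').comp
          (Complex.measurableEquivRealProd.symm.measurable.comp measurable_swap))).aemeasurable)]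
  have h0 : ∀ᵐ y : ℝ, y ≠ -a / ‖w‖ := by simp [ae_iff]
  filter_upwards [h0] with y hy
  simp [indicator, hy]

/-- The closed unit disc. -/
def unitDisc : Set ℂ := Metric.closedBall 0 1

lemma mem_unitDisc {z : ℂ} : z ∈ unitDisc ↔ z.re ^ 2 + z.im ^ 2 ≤ 1 := by
  rw [unitDisc, mem_closedBall_zero_iff, ← sq_le_one_iff₀ (norm_nonneg z), Complex.sq_norm,
    Complex.normSq_apply, sq, sq]

lemma measurableSet_unitDisc : MeasurableSet unitDisc := Metric.isClosed_closedBall.measurableSet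

lemma circle_mul_mem_unitDisc (c : Circle) {z : ℂ} : (c : ℂ) * z ∈ unitDisc ↔ z ∈ unitDisc := by
  rw [unitDisc, mem_closedBall_zero_iff, mem_closedBall_zero_iff, norm_mul, Circle.norm_coe,
    one_mul]

lemma volume_unitDisc : volume unitDisc = ENNReal.ofReal Real.pi := by
  rw [unitDisc, Complex.volume_closedBall]
  rw [ENNReal.ofReal_one, one_pow, one_mul, ENNReal.ofReal,
    Real.toNNReal_of_nonneg Real.pi_pos.le]
  rfl

/-- The area of the part of the unit disc within distance `h` of the real axis. -/
noncomputable def stripArea (h : ℝ) : ℝ≥0∞ := volume (unitDisc ∩ {z | |z.im| < h})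

lemma measurable_stripArea : Measurable stripArea :=
  Monotone.measurable fun _ _ hab => measure_mono (inter_subset_inter_right _ fun _ hz =>
    lt_of_lt_of_le hz hab)

lemma volume_inter_strip (p q : ℂ) :
    volume (unitDisc ∩ strip p q) = stripArea (|wedge p q| / ‖q - p‖) := by
  by_cases hpq : q - p = 0
  · have : q = p := sub_eq_zero.1 hpq
    subst this
    have h1 : strip q q = ∅ := by 
      ext z
      simp only [strip, wedge_self, abs_zero, mem_ofPred_eq, mem_empty_iff_false, iff_false]
      exact not_lt.2 (abs_nonneg _)
    have h2 : {z : ℂ | |z.im| < 0} = ∅ := by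
      ext z; simp
    simp [stripArea, wedge_self, h1, h2]
  obtain ⟨c, hc⟩ := exists_circle_mul_norm (q - p)
  have hr : 0 < ‖q - p‖ := norm_pos_iff.2 hpq
  have hm : MeasurableSet (strip p q) :=
    measurableSet_lt (measurable_id.wedge measurable_const).abs measurable_const
  rw [← (measurePreserving_circle_mul c).measure_preimage
    (measurableSet_unitDisc.inter hm).nullMeasurableSet, stripArea]
  congr 1
  ext z
  simp only [mem_preimage, mem_inter_iff, circle_mul_mem_unitDisc, strip, mem_ofPred_eq]
  rw [hc, wedge_circle_mul, ← hc, abs_neg, abs_mul, abs_of_pos hr, lt_div_iff₀ hr, mul_comm]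

lemma lintegral_mul_sub {a : ℝ} (ha : 0 ≤ a) :
    ∫⁻ r in Ioi (0 : ℝ), ENNReal.ofReal r * ENNReal.ofReal (a - r) =
      ENNReal.ofReal (a ^ 3 / 6) := by
  have h1 : ∀ r ∈ Ioi (0 : ℝ), ENNReal.ofReal r * ENNReal.ofReal (a - r) =
      (Ioc 0 a).indicator (fun r => ENNReal.ofReal (r * (a - r))) r := by
    intro r hr
    by_cases h : r ≤ a
    · rw [indicator_of_mem (show r ∈ Ioc 0 a from ⟨hr, h⟩), ENNReal.ofReal_mul (le_of_lt hr)]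
    · rw [indicator_of_notMem (fun h' => h h'.2), 
        ENNReal.ofReal_of_nonpos (p := a - r) (by linarith), mul_zero]
  rw [setLIntegral_congr_fun measurableSet_Ioi h1, lintegral_indicator measurableSet_Ioc,
    Measure.restrict_restrict measurableSet_Ioc,
    inter_eq_left.2 Ioc_subset_Ioi_self, ← ofReal_integral_eq_lintegral_ofReal,
    ← intervalIntegral.integral_of_le ha]
  · congr 1
    have : ∀ r : ℝ, r * (a - r) = a * r - r ^ 2 := fun r => by ring
    simp_rw [this]
    rw [intervalIntegral.integral_sub (Continuous.intervalIntegrable (by fun_prop) _ _)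
        (Continuous.intervalIntegrable (by fun_prop) _ _),
      intervalIntegral.integral_const_mul, integral_id, integral_pow]
    norm_num
    ring
  · exact (by fun_prop : Continuous fun r : ℝ => r * (a - r)).integrableOn_Ioc
  · filter_upwards [ae_restrict_mem measurableSet_Ioc] with r hr
    exact mul_nonneg hr.1.le (sub_nonneg.2 hr.2)

lemma volume_chord_inter_translate {r : ℝ} (hr : 0 < r) (y : ℝ) :
    volume {x : ℝ | x ^ 2 + y ^ 2 ≤ 1 ∧ (x + r) ^ 2 + y ^ 2 ≤ 1} =
      ENNReal.ofReal (2 * √(1 - y ^ 2) - r) := by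
  have : {x : ℝ | x ^ 2 + y ^ 2 ≤ 1 ∧ (x + r) ^ 2 + y ^ 2 ≤ 1} =
      Icc (-√(1 - y ^ 2)) (√(1 - y ^ 2) - r) := by
    ext x
    simp only [mem_ofPred_eq, mem_Icc]
    by_cases hy : y ^ 2 ≤ 1
    · have e1 : ∀ t : ℝ, t ^ 2 + y ^ 2 ≤ 1 ↔ |t| ≤ √(1 - y ^ 2) := fun t => by
        rw [← Real.sqrt_sq_eq_abs, Real.sqrt_le_sqrt_iff (by linarith)]
        constructor <;> intro h <;> linarith
      rw [e1, e1, abs_le, abs_le]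
      constructor
      · rintro ⟨⟨h1, h2⟩, h3, h4⟩
        exact ⟨h1, by linarith⟩
      · rintro ⟨h1, h2⟩
        exact ⟨⟨h1, by linarith⟩, by linarith, by linarith⟩
    · rw [Real.sqrt_eq_zero_of_nonpos (by linarith)]
      constructor
      · rintro ⟨h1, -⟩
        nlinarith [sq_nonneg x]
      · rintro ⟨h1, h2⟩
        linarith
  rw [this, Real.volume_Icc]
  congr 1
  ring

lemma lintegral_inter_translate {φ : ℝ → ℝ≥0∞} (hφ : Measurable φ) {r : ℝ} (hr : 0 < r) :
    ∫⁻ p : ℂ, {p | p ∈ unitDisc ∧ p + r ∈ unitDisc}.indicator (fun p => φ |p.im|) p =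
      ∫⁻ y : ℝ, φ |y| * ENNReal.ofReal (2 * √(1 - y ^ 2) - r) := by
  have hm : MeasurableSet {p : ℂ | p ∈ unitDisc ∧ p + r ∈ unitDisc} :=
    measurableSet_unitDisc.inter (measurableSet_unitDisc.preimage (measurable_id.add_const _))
  have hφ' : Measurable fun p : ℂ => φ |p.im| := hφ.comp Complex.measurable_im.abs
  rw [lintegral_complex_eq _ (hφ'.indicator hm)]
  refine lintegral_congr fun y => ?_
  have hm' : MeasurableSet {x : ℝ | x ^ 2 + y ^ 2 ≤ 1 ∧ (x + r) ^ 2 + y ^ 2 ≤ 1} :=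
    (measurableSet_le (f := fun x : ℝ => x ^ 2 + y ^ 2) (by fun_prop) measurable_const).inter
      (measurableSet_le (f := fun x : ℝ => (x + r) ^ 2 + y ^ 2) (by fun_prop) measurable_const)
  rw [← volume_chord_inter_translate hr, ← lintegral_indicator_const hm']
  refine lintegral_congr fun x => ?_
  simp [indicator, mem_unitDisc]

lemma lintegral_line_distance {φ : ℝ → ℝ≥0∞} (hφ : Measurable φ) :
    ∫⁻ p in unitDisc, ∫⁻ q in unitDisc, φ (|wedge p q| / ‖q - p‖) =
      ENNReal.ofReal (2 * Real.pi) *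
        ∫⁻ y : ℝ, φ |y| * ENNReal.ofReal ((2 * √(1 - y ^ 2)) ^ 3 / 6) := by
  let A : Set (ℂ × ℂ) := {y | y.1 ∈ unitDisc ∧ y.1 + y.2 ∈ unitDisc}
  have hA : MeasurableSet A := (measurableSet_unitDisc.preimage measurable_fst).inter
    (measurableSet_unitDisc.preimage (measurable_fst.add measurable_snd))
  let F : ℂ × ℂ → ℝ≥0∞ := A.indicator fun y => φ (|wedge y.1 y.2| / ‖y.2‖)
  have hF : Measurable F := Measurable.indicator (hφ.comp
    ((measurable_fst.wedge measurable_snd).abs.div measurable_snd.norm)) hA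
  have hp : ∀ p, unitDisc.indicator
      (fun p => ∫⁻ q in unitDisc, φ (|wedge p q| / ‖q - p‖)) p = ∫⁻ v, F (p, v) := by
    intro p
    by_cases hp : p ∈ unitDisc
    · rw [indicator_of_mem hp, ← lintegral_indicator measurableSet_unitDisc,
        ← lintegral_add_left_eq_self _ p]
      refine lintegral_congr fun v => ?_
      have : wedge p (p + v) = wedge p v := by simp [wedge]; ring
      by_cases h : p + v ∈ unitDisc <;> simp [F, A, hp, h, this]
    · rw [indicator_of_notMem hp]
      simp [F, A, hp]
  have hv : ∀ x ∈ polarCoord.target, ENNReal.ofReal x.1 •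
      ∫⁻ p, F (p, Complex.polarCoord.symm x) = ENNReal.ofReal x.1 *
        ∫⁻ y : ℝ, φ |y| * ENNReal.ofReal (2 * √(1 - y ^ 2) - x.1) := by
    intro x hx
    have hr : 0 < x.1 := by simpa [polarCoord] using hx.1
    rw [smul_eq_mul, ← lintegral_inter_translate hφ hr]
    congr 1
    have hc : Complex.polarCoord.symm x = x.1 * (Circle.exp x.2 : ℂ) := by
      rw [Complex.polarCoord_symm_apply, Circle.coe_exp, Complex.exp_mul_I]
      simp
    rw [hc, ← (measurePreserving_circle_mul (Circle.exp x.2)).lintegral_comp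
      (f := fun p => F (p, x.1 * (Circle.exp x.2 : ℂ))) (hF.comp measurable_prodMk_right)]
    refine lintegral_congr fun p => ?_
    have e1 : |wedge ((Circle.exp x.2 : ℂ) * p) (x.1 * (Circle.exp x.2 : ℂ))| /
        ‖(x.1 : ℂ) * (Circle.exp x.2 : ℂ)‖ = |p.im| := by
      rw [wedge_circle_mul, abs_neg, abs_mul, norm_mul, Circle.norm_coe, Complex.norm_real,
        Real.norm_eq_abs, mul_one, mul_div_cancel_left₀ _ (abs_pos.2 hr.ne').ne']
    have e2 : (Circle.exp x.2 : ℂ) * p + x.1 * (Circle.exp x.2 : ℂ) =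
        (Circle.exp x.2 : ℂ) * (p + x.1) := by ring
    have e3 : ((Circle.exp x.2 : ℂ) * p, x.1 * (Circle.exp x.2 : ℂ)) ∈ A ↔
        p ∈ {p | p ∈ unitDisc ∧ p + (x.1 : ℂ) ∈ unitDisc} := by
      simp only [A, mem_ofPred_eq, e2, circle_mul_mem_unitDisc]
    by_cases h : p ∈ {p | p ∈ unitDisc ∧ p + (x.1 : ℂ) ∈ unitDisc}
    · rw [indicator_of_mem h]
      simp only [F]
      rw [indicator_of_mem (e3.2 h), e1]
    · rw [indicator_of_notMem h]
      simp only [F]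
      rw [indicator_of_notMem (fun h' => h (e3.1 h'))]
  have hG : Measurable fun x : ℝ × ℝ => φ |x.2| * ENNReal.ofReal (2 * √(1 - x.2 ^ 2) - x.1) :=
    (hφ.comp measurable_snd.abs).mul (by fun_prop)
  have hH : Measurable fun r : ℝ => ENNReal.ofReal r *
        ∫⁻ y : ℝ, φ |y| * ENNReal.ofReal (2 * √(1 - y ^ 2) - r) :=
    ENNReal.measurable_ofReal.mul hG.lintegral_prod_right'
  have hp' : ∫⁻ p in unitDisc, ∫⁻ q in unitDisc, φ (|wedge p q| / ‖q - p‖) =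
      ∫⁻ p, ∫⁻ v, F (p, v) := by
    rw [← lintegral_indicator measurableSet_unitDisc]
    exact lintegral_congr hp
  rw [hp', lintegral_lintegral_swap (f := fun p v => F (p, v)) hF.aemeasurable,
    ← Complex.lintegral_comp_polarCoord_symm,
    setLIntegral_congr_fun polarCoord.open_target.measurableSet hv]
  have ht : polarCoord.target = Ioi (0 : ℝ) ×ˢ Ioo (-Real.pi) Real.pi := rfl
  rw [ht, Measure.volume_eq_prod, ← Measure.prod_restrict,
    lintegral_prod (fun x : ℝ × ℝ => ENNReal.ofReal x.1 *
      ∫⁻ y : ℝ, φ |y| * ENNReal.ofReal (2 * √(1 - y ^ 2) - x.1))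
      (hH.comp measurable_fst).aemeasurable]
  simp only [lintegral_const, Measure.restrict_apply_univ, Real.volume_Ioo]
  rw [lintegral_mul_const _ hH, mul_comm]
  congr 1
  · congr 1; ring
  simp_rw [← lintegral_const_mul' _ _ ENNReal.ofReal_ne_top]
  rw [lintegral_lintegral_swap
    ((ENNReal.measurable_ofReal.comp measurable_fst).mul hG).aemeasurable]
  refine lintegral_congr fun y => ?_
  rw [← lintegral_mul_sub (by positivity), ← lintegral_const_mul _ (by fun_prop)]
  refine lintegral_congr fun r => ?_
  ring

lemma image_sin_half {t : ℝ} (ht : 0 ≤ t) (ht' : t ≤ Real.pi) :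
    (fun s => Real.sin (s / 2)) '' Ioo (-t) t = Ioo (-Real.sin (t / 2)) (Real.sin (t / 2)) := by
  ext y
  constructor
  · rintro ⟨s, ⟨h1, h2⟩, rfl⟩
    rw [mem_Ioo, ← Real.sin_neg]
    exact ⟨Real.strictMonoOn_sin ⟨by linarith, by linarith⟩ ⟨by linarith, by linarith⟩
      (by linarith), Real.strictMonoOn_sin ⟨by linarith, by linarith⟩ ⟨by linarith, by linarith⟩
      (by linarith)⟩
  · rintro ⟨h1, h2⟩
    have h3 := Real.sin_le_one (t / 2)
    have hy : y ∈ Icc (-1 : ℝ) 1 := ⟨by linarith, by linarith⟩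
    have h0 : 0 ≤ Real.sin (t / 2) :=
      Real.sin_nonneg_of_nonneg_of_le_pi (by linarith) (by linarith)
    have ha : Real.arcsin (Real.sin (t / 2)) = t / 2 :=
      Real.arcsin_sin (by linarith) (by linarith)
    have h4 := Real.strictMonoOn_arcsin hy ⟨by linarith, h3⟩ h2
    have h5 := Real.strictMonoOn_arcsin ⟨by linarith, by linarith⟩ hy h1
    rw [ha] at h4
    rw [Real.arcsin_neg, ha] at h5
    refine ⟨2 * Real.arcsin y, ⟨by linarith, by linarith⟩, ?_⟩
    simp only [mul_div_cancel_left₀ _ (two_ne_zero' ℝ)]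
    exact Real.sin_arcsin hy.1 hy.2

lemma cos_half_nonneg {s t : ℝ} (ht' : t ≤ Real.pi) (hs : s ∈ Ioo (-t) t) :
    0 ≤ Real.cos (s / 2) :=
  Real.cos_nonneg_of_mem_Icc ⟨by linarith [hs.1], by linarith [hs.2]⟩

lemma sqrt_one_sub_sin_half_sq {s t : ℝ} (ht' : t ≤ Real.pi) (hs : s ∈ Ioo (-t) t) :
    √(1 - Real.sin (s / 2) ^ 2) = Real.cos (s / 2) := by
  rw [← Real.cos_sq', Real.sqrt_sq (cos_half_nonneg ht' hs)]

lemma lintegral_sin_half {t : ℝ} (ht : 0 ≤ t) (ht' : t ≤ Real.pi) (g : ℝ → ℝ≥0∞) :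
    ∫⁻ y in Ioo (-Real.sin (t / 2)) (Real.sin (t / 2)), g y =
      ∫⁻ s in Ioo (-t) t, ENNReal.ofReal (Real.cos (s / 2) / 2) * g (Real.sin (s / 2)) := by
  have hinj : InjOn (fun s => Real.sin (s / 2)) (Ioo (-t) t) := by
    intro a ha b hb hab
    have := Real.injOn_sin ⟨by linarith [ha.1], by linarith [ha.2]⟩
      ⟨by linarith [hb.1], by linarith [hb.2]⟩ hab
    linarith
  rw [← image_sin_half ht ht', lintegral_image_eq_lintegral_abs_deriv_mul measurableSet_Ioo
    (f' := fun s => Real.cos (s / 2) / 2) (fun s _ => ?_) hinj]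
  · refine setLIntegral_congr_fun measurableSet_Ioo fun s hs => ?_
    rw [abs_of_nonneg (div_nonneg (cos_half_nonneg ht' hs) zero_le_two)]
  · have := ((hasDerivAt_id s).div_const 2).sin
    simpa [div_eq_mul_inv] using this.hasDerivWithinAt

lemma lintegral_Ioo_ofReal_eq {f : ℝ → ℝ} (hf : Continuous f) {a b : ℝ} (hab : a ≤ b)
    (h : ∀ s ∈ Ioo a b, 0 ≤ f s) :
    ∫⁻ s in Ioo a b, ENNReal.ofReal (f s) = ENNReal.ofReal (∫ s in a..b, f s) := by
  rw [intervalIntegral.integral_of_le hab, integral_Ioc_eq_integral_Ioo,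
    ofReal_integral_eq_lintegral_ofReal (hf.integrableOn_Icc.mono_set Ioo_subset_Icc_self)]
  filter_upwards [ae_restrict_mem measurableSet_Ioo] with s hs using h s hs

lemma volume_chord (y : ℝ) :
    volume {x : ℝ | x ^ 2 + y ^ 2 ≤ 1} = ENNReal.ofReal (2 * √(1 - y ^ 2)) := by
  by_cases hy : y ^ 2 ≤ 1
  · have : {x : ℝ | x ^ 2 + y ^ 2 ≤ 1} = Icc (-√(1 - y ^ 2)) (√(1 - y ^ 2)) := by
      ext x
      rw [mem_ofPred_eq, mem_Icc, ← abs_le, ← Real.sqrt_sq_eq_abs,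
        Real.sqrt_le_sqrt_iff (by linarith)]
      constructor <;> intro h <;> linarith
    rw [this, Real.volume_Icc]
    congr 1
    ring
  · have : {x : ℝ | x ^ 2 + y ^ 2 ≤ 1} = ∅ := by
      ext x
      simp only [mem_ofPred_eq, mem_empty_iff_false, iff_false]
      nlinarith [sq_nonneg x]
    rw [this, Real.sqrt_eq_zero_of_nonpos (by linarith)]
    simp

lemma stripArea_eq_lintegral (h : ℝ) :
    stripArea h = ∫⁻ y in Ioo (-h) h, ENNReal.ofReal (2 * √(1 - y ^ 2)) := by
  have hm : MeasurableSet (unitDisc ∩ {z : ℂ | |z.im| < h}) :=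
    measurableSet_unitDisc.inter (measurableSet_lt Complex.measurable_im.abs measurable_const)
  rw [stripArea, ← lintegral_indicator_one hm,
    lintegral_complex_eq _ (measurable_one.indicator hm), ← lintegral_indicator measurableSet_Ioo]
  refine lintegral_congr fun y => ?_
  by_cases hy : y ∈ Ioo (-h) h
  · have hm' : MeasurableSet {x : ℝ | x ^ 2 + y ^ 2 ≤ 1} :=
      measurableSet_le (by fun_prop) measurable_const
    rw [indicator_of_mem hy, ← volume_chord, ← lintegral_indicator_one hm']
    refine lintegral_congr fun x => ?_
    have : |y| < h := abs_lt.2 hy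
    simp [indicator, mem_unitDisc, this]
  · rw [indicator_of_notMem hy]
    have : ¬|y| < h := fun h' => hy (abs_lt.1 h')
    simp [indicator, this]

lemma stripArea_sin_half {t : ℝ} (ht : 0 ≤ t) (ht' : t ≤ Real.pi) :
    stripArea (Real.sin (t / 2)) = ENNReal.ofReal (t + Real.sin t) := by
  rw [stripArea_eq_lintegral, lintegral_sin_half ht ht']
  have h : ∀ s ∈ Ioo (-t) t, ENNReal.ofReal (Real.cos (s / 2) / 2) *
      ENNReal.ofReal (2 * √(1 - Real.sin (s / 2) ^ 2)) =
      ENNReal.ofReal (1 / 2 + Real.cos s / 2) := by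
    intro s hs
    rw [sqrt_one_sub_sin_half_sq ht' hs,
      ← ENNReal.ofReal_mul (div_nonneg (cos_half_nonneg ht' hs) zero_le_two)]
    congr 1
    have := Real.cos_sq (s / 2)
    rw [mul_div_cancel₀ _ (two_ne_zero' ℝ)] at this
    linarith
  rw [setLIntegral_congr_fun measurableSet_Ioo h, lintegral_Ioo_ofReal_eq (by fun_prop)
    (by linarith) (fun s _ => by linarith [Real.neg_one_le_cos s])]
  congr 1
  rw [intervalIntegral.integral_add (Continuous.intervalIntegrable (by fun_prop) _ _)
    (Continuous.intervalIntegrable (by fun_prop) _ _), intervalIntegral.integral_div,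
    intervalIntegral.integral_div, integral_cos]
  simp

lemma abs_sin_half {s : ℝ} (hs : s ∈ Ioo (-Real.pi) Real.pi) :
    |Real.sin (s / 2)| = Real.sin (|s| / 2) := by
  rcases le_total 0 s with h | h
  · rw [abs_of_nonneg h, abs_of_nonneg]
    exact Real.sin_nonneg_of_nonneg_of_le_pi (by linarith) (by linarith [hs.2])
  · rw [abs_of_nonpos h, abs_of_nonpos, ← Real.sin_neg, neg_div]
    exact Real.sin_nonpos_of_nonpos_of_neg_pi_le (by linarith) (by linarith [hs.1])

lemma integral_even {f : ℝ → ℝ} (hf : Continuous f) (a : ℝ) (heven : ∀ s, f (-s) = f s) :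
    ∫ s in -a..a, f s = 2 * ∫ s in (0 : ℝ)..a, f s := by
  rw [← intervalIntegral.integral_add_adjacent_intervals (b := 0) (hf.intervalIntegrable _ _)
    (hf.intervalIntegrable _ _)]
  have := intervalIntegral.integral_comp_neg (a := 0) (b := a) f
  simp only [heven, neg_zero] at this
  rw [← this]; ring

lemma lintegral_stripArea_pow (n : ℕ) :
    ∫⁻ y : ℝ, stripArea |y| ^ n * ENNReal.ofReal ((2 * √(1 - y ^ 2)) ^ 3 / 6) =
      ENNReal.ofReal (1 / 3 * ∫ t in (0 : ℝ)..Real.pi,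
        (t + Real.sin t) ^ n * (1 + Real.cos t) ^ 2) := by
  have h1 : ∫⁻ y : ℝ, stripArea |y| ^ n * ENNReal.ofReal ((2 * √(1 - y ^ 2)) ^ 3 / 6) =
      ∫⁻ y in Ioo (-Real.sin (Real.pi / 2)) (Real.sin (Real.pi / 2)),
        stripArea |y| ^ n * ENNReal.ofReal ((2 * √(1 - y ^ 2)) ^ 3 / 6) := by
    rw [← lintegral_indicator measurableSet_Ioo]
    refine lintegral_congr fun y => ?_
    by_cases hy : y ∈ Ioo (-Real.sin (Real.pi / 2)) (Real.sin (Real.pi / 2))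
    · rw [indicator_of_mem hy]
    · rw [indicator_of_notMem hy, Real.sqrt_eq_zero_of_nonpos]
      · simp
      · rw [Real.sin_pi_div_two, mem_Ioo, ← abs_lt, not_lt] at hy
        have := one_le_sq_iff_one_le_abs y |>.2 hy
        linarith
  have h2 : ∀ s ∈ Ioo (-Real.pi) Real.pi, ENNReal.ofReal (Real.cos (s / 2) / 2) *
      (stripArea |Real.sin (s / 2)| ^ n *
        ENNReal.ofReal ((2 * √(1 - Real.sin (s / 2) ^ 2)) ^ 3 / 6)) =
      ENNReal.ofReal (1 / 6 * ((|s| + Real.sin |s|) ^ n * (1 + Real.cos |s|) ^ 2)) := by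
    intro s hs
    have hc := cos_half_nonneg le_rfl hs
    have hs' : |s| ≤ Real.pi := (abs_lt.2 hs).le
    have h0 : 0 ≤ |s| + Real.sin |s| :=
      add_nonneg (abs_nonneg s) (Real.sin_nonneg_of_nonneg_of_le_pi (abs_nonneg s) hs')
    rw [abs_sin_half hs, stripArea_sin_half (abs_nonneg s) hs', sqrt_one_sub_sin_half_sq le_rfl hs,
      ← ENNReal.ofReal_pow h0, ← ENNReal.ofReal_mul (by positivity),
      ← ENNReal.ofReal_mul (by positivity), Real.cos_abs]
    congr 1
    have h3 := Real.cos_sq (s / 2)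
    rw [mul_div_cancel₀ _ (two_ne_zero' ℝ)] at h3
    have h4 : 1 + Real.cos s = 2 * Real.cos (s / 2) ^ 2 := by linarith
    rw [h4]; ring
  rw [h1, lintegral_sin_half Real.pi_pos.le le_rfl, setLIntegral_congr_fun measurableSet_Ioo h2,
    lintegral_Ioo_ofReal_eq (by fun_prop) (by linarith [Real.pi_pos]) ?_,
    integral_even (by fun_prop) _ (fun s => by simp), intervalIntegral.integral_const_mul]
  · congr 1
    rw [← mul_assoc]
    congr 1
    · norm_num
    refine intervalIntegral.integral_congr fun s hs => ?_
    rw [uIcc_of_le Real.pi_pos.le] at hs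
    simp only [abs_of_nonneg hs.1]
  · intro s hs
    have hs' : |s| ≤ Real.pi := (abs_lt.2 hs).le
    have h0 := add_nonneg (abs_nonneg s) (Real.sin_nonneg_of_nonneg_of_le_pi (abs_nonneg s) hs')
    positivity

/-- The uniform distribution on the unit disc. -/
noncomputable def discMeasure : Measure ℂ := ProbabilityTheory.cond volume unitDisc

lemma discMeasure_eq_smul :
    discMeasure = (ENNReal.ofReal Real.pi)⁻¹ • volume.restrict unitDisc := by
  rw [discMeasure, ProbabilityTheory.cond, volume_unitDisc]

lemma volume_unitDisc_ne_zero : volume unitDisc ≠ 0 := by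
  simp [volume_unitDisc, Real.pi_pos]

lemma volume_unitDisc_ne_top : volume unitDisc ≠ ∞ := by
  simp [volume_unitDisc]

instance : IsProbabilityMeasure discMeasure :=
  ProbabilityTheory.cond_isProbabilityMeasure_of_finite volume_unitDisc_ne_zero
    volume_unitDisc_ne_top

lemma measurePreserving_neg_discMeasure :
    MeasurePreserving (fun z : ℂ => -z) discMeasure discMeasure := by
  rw [discMeasure_eq_smul]
  refine MeasurePreserving.smul_measure ?_ _
  have h := (Measure.measurePreserving_neg (volume : Measure ℂ)).restrict_preimage
    measurableSet_unitDisc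
  have e : Neg.neg ⁻¹' unitDisc = unitDisc := by
    ext z
    simp [unitDisc]
  rw [e] at h
  exact h

lemma discMeasure_wedge_eq (w : ℂ) (hw : w ≠ 0) (a : ℝ) : discMeasure {z | wedge z w = a} = 0 :=
  ProbabilityTheory.cond_absolutelyContinuous (volume_wedge_eq hw a)

lemma lintegral_discMeasure_strip_pow (n : ℕ) :
    ∫⁻ y, discMeasure (strip y.1 y.2) ^ n ∂(discMeasure.prod discMeasure) =
      ENNReal.ofReal (2 / (3 * Real.pi ^ (n + 1)) * ∫ t in (0 : ℝ)..Real.pi,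
        (t + Real.sin t) ^ n * (1 + Real.cos t) ^ 2) := by
  have hs : ∀ p q, discMeasure (strip p q) =
      (ENNReal.ofReal Real.pi)⁻¹ * stripArea (|wedge p q| / ‖q - p‖) := fun p q => by
    rw [← volume_inter_strip, discMeasure, ProbabilityTheory.cond_apply measurableSet_unitDisc,
      volume_unitDisc]
  rw [lintegral_prod _ (measurable_measure_strip.pow_const n).aemeasurable]
  simp_rw [hs, mul_pow, ← ENNReal.inv_pow]
  have hpi : ENNReal.ofReal Real.pi ≠ 0 := by simp [Real.pi_pos]
  have hfin : (ENNReal.ofReal Real.pi ^ n)⁻¹ ≠ ∞ := by simp [hpi]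
  have hfin' : (ENNReal.ofReal Real.pi)⁻¹ ≠ ∞ := by simp [Real.pi_pos]
  simp_rw [lintegral_const_mul' _ _ hfin]
  rw [discMeasure_eq_smul]
  simp_rw [lintegral_smul_measure, smul_eq_mul, lintegral_const_mul' _ _ hfin']
  rw [lintegral_line_distance (measurable_stripArea.pow_const n), lintegral_stripArea_pow,
    ← ENNReal.ofReal_pow Real.pi_pos.le, ← ENNReal.ofReal_inv_of_pos (by positivity),
    ← ENNReal.ofReal_inv_of_pos Real.pi_pos, ← ENNReal.ofReal_mul (by positivity),
    ← ENNReal.ofReal_mul (by positivity), ← ENNReal.ofReal_mul (by positivity),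
    ← ENNReal.ofReal_mul (by positivity)]
  congr 1
  have := Real.pi_ne_zero
  field_simp
  ring

lemma measurableSet_mem_symHull {ι : Type*} [Fintype ι] :
    MeasurableSet {y : ℂ × (ι → ℂ) | y.1 ∈ symHull y.2} :=
  isClosed_setOf_mem_symHull.measurableSet.preimage measurable_swap

lemma measurable_discMeasure_symHull {ι : Type*} [Fintype ι] :
    Measurable fun x : ι → ℂ => discMeasure.real (symHull x) :=
  (measurable_measure_prodMk_right measurableSet_mem_symHull).ennreal_toReal

/-- The expected normalized area of the symmetric hull of `n + 1` random points of the disc. -/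
theorem integral_discMeasure_symHull (n : ℕ) :
    ∫ x, discMeasure.real (symHull x) ∂(Measure.pi fun _ : Fin (n + 1) => discMeasure) =
      1 - 2 * ((n : ℝ) + 1) / (3 * Real.pi ^ (n + 1)) *
        ∫ t in (0 : ℝ)..Real.pi, (t + Real.sin t) ^ n * (1 + Real.cos t) ^ 2 := by
  have h1 : ∫ x, discMeasure.real (symHull x) ∂(Measure.pi fun _ : Fin (n + 1) => discMeasure) =
      (discMeasure.prod (Measure.pi fun _ : Fin (n + 1) => discMeasure)).real
        {y | y.1 ∈ symHull y.2} := by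
    rw [Measure.real, Measure.prod_apply_symm measurableSet_mem_symHull, ← integral_toReal]
    · rfl
    · exact (measurable_measure_prodMk_right measurableSet_mem_symHull).aemeasurable
    · exact Filter.Eventually.of_forall fun x => measure_lt_top _ _
  have h2 : (discMeasure.prod (Measure.pi fun _ : Fin (n + 1) => discMeasure)).real
      {y | y.1 ∉ symHull y.2} = ((n : ℝ) + 1) * (2 / (3 * Real.pi ^ (n + 1)) *
        ∫ t in (0 : ℝ)..Real.pi, (t + Real.sin t) ^ n * (1 + Real.cos t) ^ 2) := by
    rw [Measure.real, measure_notMem_symHull measurePreserving_neg_discMeasure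
      discMeasure_wedge_eq, lintegral_discMeasure_strip_pow, ENNReal.toReal_mul,
      ENNReal.toReal_ofReal]
    · congr 1
    · refine mul_nonneg (by positivity) (intervalIntegral.integral_nonneg Real.pi_pos.le ?_)
      intro t ht
      have := add_nonneg ht.1 (Real.sin_nonneg_of_nonneg_of_le_pi ht.1 ht.2)
      positivity
  have h3 := probReal_compl_eq_one_sub
    (μ := discMeasure.prod (Measure.pi fun _ : Fin (n + 1) => discMeasure))
    measurableSet_mem_symHull
  rw [show {y : ℂ × (Fin (n + 1) → ℂ) | y.1 ∈ symHull y.2}ᶜ = {y | y.1 ∉ symHull y.2} from rfl,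
    h2] at h3
  rw [h1]
  linear_combination h3

section LinearImage

variable {V W : Type*} [NormedAddCommGroup V] [InnerProductSpace ℝ V] [FiniteDimensional ℝ V]
  [MeasurableSpace V] [BorelSpace V] [NormedAddCommGroup W] [InnerProductSpace ℝ W]
  [FiniteDimensional ℝ W] [MeasurableSpace W] [BorelSpace W]

lemma exists_volume_eq_mul_volume_image (L : V ≃L[ℝ] W) :
    ∃ c : ℝ≥0∞, c ≠ 0 ∧ c ≠ ∞ ∧ ∀ s : Set V, volume s = c * volume (L '' s) := by
  have h := L.isAddHaarMeasure_map (volume : Measure V)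
  refine ⟨Measure.addHaarScalarFactor (Measure.map L volume) (volume : Measure W),
    ENNReal.coe_ne_zero.2 (Measure.addHaarScalarFactor_pos_of_isAddHaarMeasure _ _).ne',
    ENNReal.coe_ne_top, fun s => ?_⟩
  have e := congrArg (fun μ => μ (L '' s))
    (Measure.isAddLeftInvariant_eq_smul (Measure.map L (volume : Measure V)) volume)
  simp only [Measure.smul_apply] at e
  have hL : MeasurableEmbedding L := L.toHomeomorph.measurableEmbedding
  rw [← smul_eq_mul, ← ENNReal.smul_def, ← e, hL.map_apply]
  exact congrArg _ (preimage_image_eq s L.injective).symm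

lemma cond_volume_image_apply (L : V ≃L[ℝ] W) {s : Set V} (hs : MeasurableSet s) (t : Set V) :
    ProbabilityTheory.cond volume (L '' s) (L '' t) = ProbabilityTheory.cond volume s t := by
  obtain ⟨c, h0, ht, hc⟩ := exists_volume_eq_mul_volume_image L
  have hs' : MeasurableSet (L '' s) := L.toHomeomorph.measurableEmbedding.measurableSet_image.2 hs
  rw [ProbabilityTheory.cond_apply hs', ProbabilityTheory.cond_apply hs,
    ← image_inter L.injective, hc s, hc (s ∩ t), ENNReal.mul_inv (Or.inl h0) (Or.inl ht),
    mul_mul_mul_comm, ENNReal.inv_mul_cancel h0 ht, one_mul]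

end LinearImage

/-- The linear map that takes the unit disc to the ellipse with axes `b` and semi-axes `a`. -/
noncomputable def ellipseEquiv (b : OrthonormalBasis (Fin 2) ℝ (EuclideanSpace ℝ (Fin 2)))
    (a : Fin 2 → ℝ) (ha : ∀ i, 0 < a i) : ℂ ≃L[ℝ] EuclideanSpace ℝ (Fin 2) :=
  LinearEquiv.toContinuousLinearEquiv
    { toFun := fun z => (a 0 * z.re) • b 0 + (a 1 * z.im) • b 1
      map_add' := fun z w => by simp only [Complex.add_re, Complex.add_im]; module
      map_smul' := fun r z => by
        simp only [Complex.real_smul, Complex.mul_re, Complex.mul_im, Complex.ofReal_re,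
          Complex.ofReal_im, RingHom.id_apply]
        module
      invFun := fun x => ⟨inner ℝ (b 0) x / a 0, inner ℝ (b 1) x / a 1⟩
      left_inv := fun z => by
        have h0 := (ha 0).ne'
        have h1 := (ha 1).ne'
        apply Complex.ext <;>
          simp [inner_add_right, inner_smul_right, b.inner_eq_ite, h0, h1]
      right_inv := fun x => by
        have h0 := (ha 0).ne'
        have h1 := (ha 1).ne'
        simp only [mul_div_cancel₀ _ h0, mul_div_cancel₀ _ h1]
        rw [← Fin.sum_univ_two (fun i => inner ℝ (b i) x • b i), b.sum_repr'] }

lemma ellipseEquiv_image_unitDisc (b : OrthonormalBasis (Fin 2) ℝ (EuclideanSpace ℝ (Fin 2)))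
    (a : Fin 2 → ℝ) (ha : ∀ i, 0 < a i) :
    ellipseEquiv b a ha '' unitDisc = {x | ∑ i, (inner ℝ (b i) x / a i) ^ 2 ≤ 1} := by
  rw [(ellipseEquiv b a ha).image_eq_preimage_symm]
  ext x
  rw [mem_preimage, mem_unitDisc, mem_ofPred_eq, Fin.sum_univ_two]
  rfl

theorem mainTheorem6 {Ω : Type*} [MeasurableSpace Ω] (P : MeasureTheory.Measure Ω)
    [MeasureTheory.IsProbabilityMeasure P]
    (E : Set (EuclideanSpace ℝ (Fin 2))) (hE : IsCenteredEllipse E)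
    (N : ℕ) (hN : 2 ≤ N)
    (x : Fin N → Ω → EuclideanSpace ℝ (Fin 2))
    (hindep : ProbabilityTheory.iIndepFun x P)
    (hunif : ∀ i, MeasureTheory.pdf.IsUniform (x i) E P MeasureTheory.volume) :
    MeasureTheory.Integrable (fun ω => normalizedSymVolume E (fun i => x i ω)) P ∧
      ∫ ω, normalizedSymVolume E (fun i => x i ω) ∂P =
        1 - 2 * (N : ℝ) / (3 * Real.pi ^ N) *
          ∫ t in (0 : ℝ)..Real.pi, (t + Real.sin t) ^ (N - 1) * (1 + Real.cos t) ^ 2 := by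
  obtain ⟨b, a, ha, hEq⟩ := hE
  obtain ⟨n, rfl⟩ : ∃ n, N = n + 1 := ⟨N - 1, by omega⟩
  set L := ellipseEquiv b a ha
  rw [← ellipseEquiv_image_unitDisc b a ha] at hEq
  have hmE : MeasurableSet E := hEq ▸
    L.toHomeomorph.measurableEmbedding.measurableSet_image.2 measurableSet_unitDisc
  have hcond : ∀ t : Set ℂ, ProbabilityTheory.cond volume E (L '' t) = discMeasure t := fun t => by
    rw [hEq, cond_volume_image_apply L measurableSet_unitDisc, discMeasure]
  have hx : ∀ i, AEMeasurable (x i) P := fun i => by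
    refine AEMeasurable.of_map_ne_zero ?_
    rw [hunif i]
    intro h
    have := hcond univ
    simp [h] at this
  have hL : Measurable L.symm := L.symm.continuous.measurable
  have hlaw : ∀ i, P.map (fun ω => L.symm (x i ω)) = discMeasure := fun i => by
    have := AEMeasurable.map_map_of_aemeasurable (μ := P) hL.aemeasurable (hx i)
    change P.map (L.symm ∘ x i) = _
    rw [← this, hunif i]
    ext t ht
    rw [Measure.map_apply hL ht, ← hcond, L.image_eq_preimage_symm]
  have hy : ∀ i, AEMeasurable (fun ω => L.symm (x i ω)) P := fun i => hL.comp_aemeasurable (hx i)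
  have hpi : P.map (fun ω i => L.symm (x i ω)) = Measure.pi fun _ : Fin (n + 1) => discMeasure := by
    have := (ProbabilityTheory.iIndepFun_iff_map_fun_eq_pi_map hy).1
      (hindep.comp (fun _ => L.symm) fun _ => hL)
    simpa only [hlaw] using this
  have hmem : ∀ᵐ ω ∂P, ∀ i, L.symm (x i ω) ∈ unitDisc := by
    refine ae_all_iff.2 fun i => ae_of_ae_map (hy i) ?_
    rw [hlaw i]
    exact ProbabilityTheory.ae_cond_mem measurableSet_unitDisc
  have hvol : ∀ᵐ ω ∂P, normalizedSymVolume E (fun i => x i ω) =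
      discMeasure.real (symHull fun i => L.symm (x i ω)) := by
    filter_upwards [hmem] with ω hω
    have himg : symmetricHull (fun i => x i ω) = L '' symHull fun i => L.symm (x i ω) := by
      have := image_symHull (L : ℂ →ₗ[ℝ] EuclideanSpace ℝ (Fin 2)) fun i => L.symm (x i ω)
      simpa [symHull, symmetricHull] using this.symm
    have hsub : (symHull fun i => L.symm (x i ω)) ⊆ unitDisc :=
      symHull_subset (convex_closedBall 0 1) hω fun i => by simpa [unitDisc] using hω i
    have hsubE : symmetricHull (fun i => x i ω) ⊆ E := by
      rw [himg, hEq]; exact image_mono hsub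
    rw [normalizedSymVolume, Measure.real, Measure.real, Measure.real, ← hcond, ← himg,
      ProbabilityTheory.cond_apply hmE, inter_eq_right.2 hsubE, ENNReal.toReal_mul,
      ENNReal.toReal_inv, div_eq_inv_mul]
  have hyall : AEMeasurable (fun ω i => L.symm (x i ω)) P := aemeasurable_pi_lambda _ hy
  have hmeas := measurable_discMeasure_symHull (ι := Fin (n + 1))
  constructor
  · refine (Integrable.of_bound (hmeas.comp_aemeasurable hyall).aestronglyMeasurable 1
      (Filter.Eventually.of_forall fun ω => ?_)).congr (hvol.mono fun ω h => h.symm)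
    simp only [Function.comp, Real.norm_eq_abs, abs_of_nonneg measureReal_nonneg]
    exact measureReal_le_one
  · rw [integral_congr_ae hvol, ← integral_map (f := fun y => discMeasure.real (symHull y)) hyall
      hmeas.aestronglyMeasurable, hpi, integral_discMeasure_symHull]
    simp
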